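/- For a positive integer $m$ that is a sum of two integer squares, put $\lambda = 2\pi\sqrt{m}$ (so that $\lambda^2 = 4\pi^2 m$ is an eigenvalue of $-\Delta$ on the torus $\mathbb{R}^2/\mathbb{Z}^2$) and let $\mathcal{E}_\lambda = \{\mu = (a,b) \in \mathbb{Z}^2 : a^2+b^2 = m\}$. Say that a property holds for almost all $\lambda$ if the proportion of those $m$ for which it fails, among the positive integers $m \le x$ that are sums of two squares, tends to $0$ as $x \to \infty$. Then for every fixed $\varepsilon > 0$ there is a constant $c > 0$, depending only on $\varepsilon$, such that for almost all $\lambda$ $$\min_{\mu_1 \neq \mu_2 \in \mathcal{E}_\lambda} \|\mu_1 - \mu_2\| \;\ge\; c\,\frac{\lambda}{(\log \lambda)^{3/2+\varepsilon}},$$ where $\|\cdot\|$ is the Euclidean norm. -/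

import Mathlib

open Filter Topology

namespace ToralSeparation

/-- The positive integers that are sums of two integer squares. The Laplace eigenvalues of the
flat torus `ℝ² / ℤ²` that are nonzero are exactly the numbers `4 * π ^ 2 * m` for such `m`. -/
def sumsOfTwoSquares : Set ℕ :=
  {m | 0 < m ∧ ∃ a b : ℤ, a ^ 2 + b ^ 2 = (m : ℤ)}

/-- The frequency `λ` with `λ ^ 2 = 4 * π ^ 2 * m`. -/
noncomputable def frequency (m : ℕ) : ℝ :=
  2 * Real.pi * Real.sqrt m

/-- The integer lattice points on the circle `μ₁ ^ 2 + μ₂ ^ 2 = m`. -/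
def latticePoints (m : ℕ) : Set (ℤ × ℤ) :=
  {μ | μ.1 ^ 2 + μ.2 ^ 2 = (m : ℤ)}

/-- The lattice point `μ` as a vector of the Euclidean plane (with the `ℓ²` norm). -/
noncomputable def toPlane (μ : ℤ × ℤ) : EuclideanSpace ℝ (Fin 2) :=
  !₂[(μ.1 : ℝ), (μ.2 : ℝ)]

/-- `P` holds for almost all elements of `S`: among the elements of `S` up to `x`, the proportion
of those for which `P` fails tends to `0` as `x → ∞`. -/
def AlmostAllIn (S : Set ℕ) (P : ℕ → Prop) : Prop :=
  Tendsto
    (fun x : ℕ => ({m | m ∈ S ∧ m ≤ x ∧ ¬ P m}.ncard : ℝ) / ({m | m ∈ S ∧ m ≤ x}.ncard : ℝ))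
    atTop (𝓝 0)

end ToralSeparation

/-! Suppose `μ ≠ ν` lie on the circle of radius `√m`, with `m ≤ x`. Write `μ - ν = g (p, q)` with
`(p, q)` primitive. Since `|μ| = |ν|`, the vector `μ + ν` is orthogonal to `(p, q)`, hence equals `t
(q, -p)` for an integer `t`, and the parallelogram law gives `4m = (g² + t²)(p² + q²)`
(`exists_factorization`). Let `h ≥ j` be the absolute values of `p` and `q`. If the distance is at
most `D`, then `g h ≤ D` and `|t| h ≤ 2√x`. Counting the quadruples `(g, h, j, |t|)` shows that O(√x
· D · log D) values of `m` have such a pair (`card_close_pairs_le_log`). For `D` of order `√x / (log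
x)^(3/2+ε)` this is O(x / (log x)^(1/2+ε)).

It remains to know that the sums of two squares up to `x` number at least a constant times `x /
√(log x)`, the lower half of Landau's theorem (`le_sum_indSq`). Let `b` be their indicator and
`B(N)` its summatory function. As `b` is supermultiplicative, `b * (bΛ) ≤ b log`, so `B(N) log N`
dominates the sum of `b * (bΛ)`. A Chebyshev bound for `bΛ` makes this at least of order `N ∑
b(m)/m`. That sum is at least of order `√(log N)`, because `χ * 1 ≤ b * b` and `∑ (χ * 1)(n)/n` is
at least `(2/3) log N`. The Chebyshev bound follows from Mertens' theorems for `Λ` and `χΛ`. -/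

namespace ToralSeparation

open Finset ArithmeticFunction

/-! ### The character modulo 4 and summation by parts -/

/-- The nontrivial character modulo `4`, with real values. -/
noncomputable def chi (n : ℕ) : ℝ := (ZMod.χ₄ (n : ZMod 4) : ℤ)

lemma chi_eq (n : ℕ) : chi n = if n % 2 = 0 then 0 else if n % 4 = 1 then 1 else -1 := by
  rw [chi, ZMod.χ₄_nat_eq_if_mod_four]
  split_ifs <;> simp

lemma chi_mul (m n : ℕ) : chi (m * n) = chi m * chi n := by
  simp only [chi, Nat.cast_mul, map_mul, Int.cast_mul]

lemma chi_one : chi 1 = 1 := by simp [chi_eq]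

lemma chi_pow (m k : ℕ) : chi (m ^ k) = chi m ^ k := by
  simp only [chi, Nat.cast_pow, map_pow, Int.cast_pow]

lemma abs_chi_le (n : ℕ) : |chi n| ≤ 1 := by
  rw [chi_eq]
  split_ifs <;> simp

lemma sum_chi (n : ℕ) :
    ∑ i ∈ Ioc 0 n, chi i = if n % 4 = 1 ∨ n % 4 = 2 then 1 else 0 := by
  induction n with
  | zero => simp
  | succ n ih =>
    rw [sum_Ioc_succ_top (Nat.zero_le n), ih, chi_eq]
    have h : n % 4 < 4 := Nat.mod_lt _ (by norm_num)
    split_ifs <;> first | omega | norm_num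

lemma abs_sum_chi_Ioc_le {M N : ℕ} (h : M ≤ N) : |∑ i ∈ Ioc M N, chi i| ≤ 1 := by
  have e : ∑ i ∈ Ioc M N, chi i = ∑ i ∈ Ioc 0 N, chi i - ∑ i ∈ Ioc 0 M, chi i := by
    rw [← sum_Ioc_consecutive chi (Nat.zero_le M) h]; ring
  rw [e, sum_chi, sum_chi]
  split_ifs <;> simp

/-- Summation by parts for the character modulo `4` against a decreasing function. -/
lemma abs_sum_chi_mul_le {f : ℕ → ℝ} {M N : ℕ} (h0 : ∀ n, 0 ≤ f n)
    (hf : ∀ n, M < n → n < N → f (n + 1) ≤ f n) :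
    |∑ n ∈ Ioc M N, chi n * f n| ≤ f (M + 1) := by
  rcases Nat.lt_or_ge M N with h | h
  swap
  · simp [Ioc_eq_empty_of_le h, h0]
  -- Peeling off the boundary term leaves a bound that telescopes as `K` grows; at `K = N` the
  -- boundary term is at most `f N` in absolute value, which restores `f (M + 1)`.
  have key : ∀ K, M + 1 ≤ K → K ≤ N →
      |∑ n ∈ Ioc M K, chi n * f n - (∑ n ∈ Ioc M K, chi n) * f K| ≤ f (M + 1) - f K := by
    intro K hK
    induction K, hK using Nat.le_induction with
    | base => intro _; simp
    | succ K hK ih =>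
      intro hKN
      have i1 := abs_le.1 (ih (by omega))
      have i2 := abs_le.1 (abs_sum_chi_Ioc_le (show M ≤ K by omega))
      have i3 := hf K (by omega) (by omega)
      rw [sum_Ioc_succ_top (by omega), sum_Ioc_succ_top (by omega)]
      generalize ∑ n ∈ Ioc M K, chi n * f n = E at *
      generalize ∑ n ∈ Ioc M K, chi n = t at *
      rw [abs_le]
      constructor <;> nlinarith
  have k1 := abs_le.1 (key N h le_rfl)
  have k2 := abs_le.1 (abs_sum_chi_Ioc_le h.le)
  have k3 := h0 N
  rw [abs_le]
  constructor <;> nlinarith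

lemma chi_two : chi 2 = 0 := by norm_num [chi_eq]

/-- The term at 2 vanishes and the tail from 3 on is at most `f 3` in absolute value, so
monotonicity is needed only from 3 onwards. -/
lemma le_sum_chi_mul {f : ℕ → ℝ} {N : ℕ} (h0 : ∀ n, 0 ≤ f n)
    (hf : ∀ n, 2 < n → n < N → f (n + 1) ≤ f n) (hN : 0 < N) :
    f 1 - f 3 ≤ ∑ n ∈ Ioc 0 N, chi n * f n := by
  rcases Nat.lt_or_ge N 2 with h | h
  · obtain rfl : N = 1 := by omega
    simp [chi_one, h0]
  rw [← sum_Ioc_consecutive _ (Nat.zero_le 2) h]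
  have := abs_le.1 (abs_sum_chi_mul_le h0 hf)
  have e : ∑ n ∈ Ioc 0 2, chi n * f n = f 1 := by
    rw [show Ioc 0 2 = {1, 2} by decide]
    simp [chi_one, chi_two]
  linarith

/-- Multiplication by a completely multiplicative weight commutes with Dirichlet convolution. -/
lemma sum_weight_mul {w : ℕ → ℝ} (hw : ∀ m n, w (m * n) = w m * w n)
    (f g : ArithmeticFunction ℝ) (N : ℕ) :
    ∑ n ∈ Ioc 0 N, w n * (f * g) n =
      ∑ d ∈ Ioc 0 N, w d * f d * ∑ m ∈ Ioc 0 (N / d), w m * g m := by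
  let F : ArithmeticFunction ℝ := ⟨fun n => w n * f n, by simp⟩
  let G : ArithmeticFunction ℝ := ⟨fun n => w n * g n, by simp⟩
  have h := sum_Ioc_mul_eq_sum_sum F G N
  have e : ∀ n, (F * G) n = w n * (f * g) n := by
    intro n
    rw [mul_apply, mul_apply, mul_sum]
    refine sum_congr rfl fun x hx => ?_
    rw [← (Nat.mem_divisorsAntidiagonal.1 hx).1, hw]
    simp only [F, G, coe_mk]
    ring
  simp only [e] at h
  exact h

lemma inv_natCast_mul (m n : ℕ) : ((m * n : ℕ) : ℝ)⁻¹ = (m : ℝ)⁻¹ * (n : ℝ)⁻¹ := by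
  push_cast
  rw [mul_inv]

lemma zeta_apply_pos {n : ℕ} (h : 0 < n) : (zeta : ArithmeticFunction ℝ) n = 1 := by
  simp [h.ne']

/-! ### Mertens' theorems for the von Mangoldt function -/

lemma sum_vonMangoldt_le : ∃ C : ℝ, 0 < C ∧ ∀ N : ℕ, ∑ n ∈ Ioc 0 N, Λ n ≤ C * N := by
  refine ⟨Real.log 4 + 4, by positivity, fun N => ?_⟩
  simpa [Chebyshev.psi] using Chebyshev.psi_le_const_mul_self (Nat.cast_nonneg N)

lemma sum_log_eq (N : ℕ) : ∑ n ∈ Ioc 0 N, Real.log n = Real.log N.factorial := by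
  induction N with
  | zero => simp
  | succ n ih =>
    rw [sum_Ioc_succ_top (Nat.zero_le n), ih, Nat.factorial_succ, Nat.cast_mul,
      Real.log_mul (by positivity) (by positivity), add_comm]

lemma sum_log_ge {N : ℕ} (hN : 0 < N) : N * Real.log N - N ≤ ∑ n ∈ Ioc 0 N, Real.log n := by
  rw [sum_log_eq]
  have h := Stirling.le_log_factorial_stirling hN.ne'
  have h1 : 0 ≤ Real.log N := Real.log_natCast_nonneg N
  have h2 : 0 ≤ Real.log (2 * Real.pi) := Real.log_nonneg (by linarith [Real.pi_gt_three])
  linarith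

lemma sum_log_le (N : ℕ) : ∑ n ∈ Ioc 0 N, Real.log n ≤ N * Real.log N := by
  calc _ ≤ ∑ n ∈ Ioc 0 N, Real.log N := by
        refine sum_le_sum fun n hn => ?_
        rw [mem_Ioc] at hn
        exact Real.log_le_log (by exact_mod_cast hn.1) (by exact_mod_cast hn.2)
    _ = _ := by simp

lemma sum_log_eq_sum_vonMangoldt (N : ℕ) :
    ∑ n ∈ Ioc 0 N, Real.log n = ∑ d ∈ Ioc 0 N, Λ d * ((N / d : ℕ) : ℝ) := by
  rw [← sum_Ioc_mul_zeta_eq_sum, vonMangoldt_mul_zeta]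
  rfl

lemma natCast_div_gt (N : ℕ) {d : ℕ} (hd : 0 < d) : (N : ℝ) / d < ((N / d : ℕ) : ℝ) + 1 := by
  rw [div_lt_iff₀ (by exact_mod_cast hd)]
  have := Nat.lt_div_mul_add (a := N) hd
  rw [add_mul, one_mul]
  exact_mod_cast this

/-- Mertens' first theorem. -/
lemma abs_sum_vonMangoldt_div_sub_log_le : ∃ C : ℝ, ∀ N : ℕ, 0 < N →
    |∑ n ∈ Ioc 0 N, (n : ℝ)⁻¹ * Λ n - Real.log N| ≤ C := by
  obtain ⟨C, hC, h⟩ := sum_vonMangoldt_le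
  refine ⟨max 1 C, fun N hN => ?_⟩
  have hN' : (0 : ℝ) < N := by exact_mod_cast hN
  have e : ∑ n ∈ Ioc 0 N, Λ n * ((N : ℝ) / n) = N * ∑ n ∈ Ioc 0 N, (n : ℝ)⁻¹ * Λ n := by
    rw [mul_sum]
    refine sum_congr rfl fun n _ => by ring
  have u1 : ∑ n ∈ Ioc 0 N, Real.log n ≤ ∑ n ∈ Ioc 0 N, Λ n * ((N : ℝ) / n) := by
    rw [sum_log_eq_sum_vonMangoldt]
    exact sum_le_sum fun n _ => mul_le_mul_of_nonneg_left Nat.cast_div_le vonMangoldt_nonneg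
  -- Dropping the floor in `N / d` costs at most 1 per term, hence at most `ψ(N) ≤ C N` in total.
  have u2 : ∑ n ∈ Ioc 0 N, Λ n * ((N : ℝ) / n) ≤ ∑ n ∈ Ioc 0 N, Real.log n + C * N := by
    refine le_trans ?_ (add_le_add_right (h N) _)
    rw [sum_log_eq_sum_vonMangoldt, ← sum_add_distrib]
    refine sum_le_sum fun n hn => ?_
    have := (natCast_div_gt N (mem_Ioc.1 hn).1).le
    nlinarith [vonMangoldt_nonneg (n := n)]
  have l1 := sum_log_ge hN
  have l2 := sum_log_le N
  rw [e] at u1 u2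
  rw [abs_le]
  constructor
  · have : -1 ≤ ∑ n ∈ Ioc 0 N, (n : ℝ)⁻¹ * Λ n - Real.log N := by
      by_contra! hh
      nlinarith
    linarith [le_max_left 1 C]
  · have : ∑ n ∈ Ioc 0 N, (n : ℝ)⁻¹ * Λ n - Real.log N ≤ C := by
      by_contra! hh
      nlinarith
    linarith [le_max_right 1 C]

lemma abs_sum_chi_log_le (N : ℕ) :
    |∑ n ∈ Ioc 0 N, chi n * (Real.log n / n)| ≤ Real.log 3 / 3 := by
  have h0 : ∀ n : ℕ, 0 ≤ Real.log n / n := fun n =>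
    div_nonneg (Real.log_natCast_nonneg n) (Nat.cast_nonneg n)
  have hf : ∀ n : ℕ, 2 < n → n < N →
      Real.log ((n + 1 : ℕ) : ℝ) / ((n + 1 : ℕ) : ℝ) ≤ Real.log n / n := by
    intro n hn _
    have h3 : (3 : ℝ) ≤ n := by exact_mod_cast hn
    have he := Real.exp_one_lt_d9
    refine Real.log_div_self_antitoneOn (?_ : Real.exp 1 ≤ (n : ℝ))
      (?_ : Real.exp 1 ≤ ((n + 1 : ℕ) : ℝ)) (by push_cast; linarith)
    · linarith
    · push_cast; linarith
  -- `log n / n` decreases only beyond `e`, so summation by parts starts at 3; the terms at 1 and 2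
  -- vanish because `log 1 = 0` and `χ(2) = 0`.
  have key := abs_sum_chi_mul_le h0 hf
  rcases Nat.lt_or_ge N 2 with h | h
  · have : N = 0 ∨ N = 1 := by omega
    rcases this with rfl | rfl <;> simp <;> positivity
  rw [← sum_Ioc_consecutive _ (Nat.zero_le 2) h]
  have e : ∑ n ∈ Ioc 0 2, chi n * (Real.log n / n) = 0 := by
    rw [show Ioc 0 2 = {1, 2} by decide]
    simp [chi_two]
  rw [e, zero_add]
  simpa using key

lemma inv_natCast_antitone {m n : ℕ} (hm : 0 < m) (h : m ≤ n) : (n : ℝ)⁻¹ ≤ (m : ℝ)⁻¹ :=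
  inv_anti₀ (by exact_mod_cast hm) (by exact_mod_cast h)

/-- A form of `L(1, χ) ≠ 0` uniform in the truncation: the bound is `1 - 1/3`. It permits division
by the partial sum in Mertens' theorem for the character. -/
lemma two_thirds_le_sum_chi_inv {N : ℕ} (hN : 0 < N) :
    2 / 3 ≤ ∑ n ∈ Ioc 0 N, chi n * (n : ℝ)⁻¹ := by
  have := le_sum_chi_mul (f := fun n => (n : ℝ)⁻¹) (N := N) (fun n => by positivity)
    (fun n hn _ => inv_natCast_antitone (by omega) (Nat.le_succ n)) hN
  norm_num at this ⊢
  exact this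

lemma abs_sum_chi_inv_sub_le {M N : ℕ} (h : M ≤ N) :
    |∑ n ∈ Ioc 0 N, chi n * (n : ℝ)⁻¹ - ∑ n ∈ Ioc 0 M, chi n * (n : ℝ)⁻¹| ≤
      ((M : ℝ) + 1)⁻¹ := by
  rw [← sum_Ioc_consecutive _ (Nat.zero_le M) h, add_sub_cancel_left]
  have := abs_sum_chi_mul_le (f := fun n => (n : ℝ)⁻¹) (M := M) (N := N) (fun n => by positivity)
    (fun n hn _ => inv_natCast_antitone (by omega) (Nat.le_succ n))
  simpa using this

/-- Mertens' theorem for the character modulo `4`. -/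
lemma abs_sum_chi_vonMangoldt_le : ∃ C : ℝ, ∀ N : ℕ, 0 < N →
    |∑ n ∈ Ioc 0 N, chi n * (n : ℝ)⁻¹ * Λ n| ≤ C := by
  obtain ⟨C, hC, hψ⟩ := sum_vonMangoldt_le
  refine ⟨3 / 2 * (Real.log 3 / 3 + C), fun N hN => ?_⟩
  have hN' : (0 : ℝ) < N := by exact_mod_cast hN
  set G : ℕ → ℝ := fun M => ∑ n ∈ Ioc 0 M, chi n * (n : ℝ)⁻¹ with hG
  set S := ∑ n ∈ Ioc 0 N, chi n * (n : ℝ)⁻¹ * Λ n with hS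
  have e1 : ∑ n ∈ Ioc 0 N, chi n * (Real.log n / n) =
      ∑ d ∈ Ioc 0 N, chi d * (d : ℝ)⁻¹ * Λ d * G (N / d) := by
    have h := sum_weight_mul (w := fun n => chi n * (n : ℝ)⁻¹)
      (fun m n => by simp only [chi_mul, inv_natCast_mul]; ring) Λ (zeta : ArithmeticFunction ℝ) N
    rw [vonMangoldt_mul_zeta] at h
    calc _ = ∑ n ∈ Ioc 0 N, chi n * (n : ℝ)⁻¹ * ArithmeticFunction.log n :=
          sum_congr rfl fun n _ => by rw [log_apply]; ring
      _ = _ := by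
          rw [h]
          refine sum_congr rfl fun d _ => ?_
          congr 1
          refine sum_congr rfl fun m hm => ?_
          rw [zeta_apply_pos (mem_Ioc.1 hm).1, mul_one]
  -- The inner sums `G (N / d)` are replaced by the common value `G N`. The error is at most `d / N`
  -- for each `d`, which cancels the weight `1 / d` and leaves `ψ(N) / N`.
  have e2 : G N * S - ∑ n ∈ Ioc 0 N, chi n * (Real.log n / n) =
      ∑ d ∈ Ioc 0 N, chi d * (d : ℝ)⁻¹ * Λ d * (G N - G (N / d)) := by
    rw [e1, hS, mul_sum, ← sum_sub_distrib]
    exact sum_congr rfl fun d _ => by ring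
  have e3 : |∑ d ∈ Ioc 0 N, chi d * (d : ℝ)⁻¹ * Λ d * (G N - G (N / d))| ≤ C := by
    calc _ ≤ ∑ d ∈ Ioc 0 N, |chi d * (d : ℝ)⁻¹ * Λ d * (G N - G (N / d))| :=
          abs_sum_le_sum_abs _ _
      _ ≤ ∑ d ∈ Ioc 0 N, Λ d * (N : ℝ)⁻¹ := by
          refine sum_le_sum fun d hd => ?_
          have hd0 : (0 : ℝ) < d := by exact_mod_cast (mem_Ioc.1 hd).1
          have b1 := abs_sum_chi_inv_sub_le (Nat.div_le_self N d)
          have b2 : (((N / d : ℕ) : ℝ) + 1)⁻¹ ≤ ((N : ℝ) / d)⁻¹ :=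
            inv_anti₀ (by positivity) (natCast_div_gt N (mem_Ioc.1 hd).1).le
          rw [inv_div] at b2
          have hΛ := vonMangoldt_nonneg (n := d)
          calc _ = |chi d| * ((d : ℝ)⁻¹ * Λ d) * |G N - G (N / d)| := by
                rw [abs_mul, abs_mul, abs_mul, abs_of_nonneg hΛ,
                  abs_of_pos (inv_pos.2 hd0)]
                ring
            _ ≤ 1 * ((d : ℝ)⁻¹ * Λ d) * (d / N) := by
                gcongr
                · exact abs_chi_le d
                · exact b1.trans b2
            _ = _ := by field_simp
      _ = (∑ d ∈ Ioc 0 N, Λ d) * (N : ℝ)⁻¹ := by rw [sum_mul]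
      _ ≤ C * N * (N : ℝ)⁻¹ := by gcongr; exact hψ N
      _ = C := by field_simp
  have e4 := abs_sum_chi_log_le N
  have hGN : 2 / 3 ≤ G N := two_thirds_le_sum_chi_inv hN
  have e5 : |G N * S| ≤ Real.log 3 / 3 + C := by
    rw [← e2] at e3
    calc |G N * S| = |∑ n ∈ Ioc 0 N, chi n * (Real.log n / n) +
          (G N * S - ∑ n ∈ Ioc 0 N, chi n * (Real.log n / n))| := by congr 1; ring
      _ ≤ _ := (abs_add_le _ _).trans (add_le_add e4 e3)
  rw [abs_mul, abs_of_nonneg (by linarith)] at e5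
  nlinarith [abs_nonneg S]

/-! ### Prime powers that are sums of two squares -/

open Classical in
/-- The indicator function of the positive sums of two squares. -/
noncomputable def indSq : ArithmeticFunction ℝ :=
  ⟨fun n => if n ∈ sumsOfTwoSquares then 1 else 0, by simp [sumsOfTwoSquares]⟩

open Classical in
lemma indSq_apply (n : ℕ) : indSq n = if n ∈ sumsOfTwoSquares then 1 else 0 := rfl

lemma indSq_of_mem {n : ℕ} (h : n ∈ sumsOfTwoSquares) : indSq n = 1 := by
  simp [indSq_apply, h]

lemma indSq_nonneg (n : ℕ) : 0 ≤ indSq n := by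
  rw [indSq_apply]; split_ifs <;> norm_num

lemma mul_mem_sumsOfTwoSquares {m n : ℕ} (hm : m ∈ sumsOfTwoSquares)
    (hn : n ∈ sumsOfTwoSquares) : m * n ∈ sumsOfTwoSquares := by
  obtain ⟨hm0, a, b, hab⟩ := hm
  obtain ⟨hn0, c, d, hcd⟩ := hn
  refine ⟨Nat.mul_pos hm0 hn0, ?_⟩
  obtain ⟨x, y, h⟩ := sq_add_sq_mul hab.symm hcd.symm
  exact ⟨x, y, by push_cast; exact h.symm⟩

lemma indSq_mul_le (m n : ℕ) : indSq m * indSq n ≤ indSq (m * n) := by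
  by_cases hm : m ∈ sumsOfTwoSquares
  · by_cases hn : n ∈ sumsOfTwoSquares
    · rw [indSq_of_mem hm, indSq_of_mem hn, indSq_of_mem (mul_mem_sumsOfTwoSquares hm hn), mul_one]
    · rw [indSq_apply n, if_neg hn, mul_zero]
      exact indSq_nonneg _
  · rw [indSq_apply m, if_neg hm, zero_mul]
    exact indSq_nonneg _

lemma one_mem_sumsOfTwoSquares : 1 ∈ sumsOfTwoSquares := ⟨one_pos, 1, 0, by norm_num⟩

lemma pow_mem_sumsOfTwoSquares {m : ℕ} (hm : m ∈ sumsOfTwoSquares) (k : ℕ) :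
    m ^ k ∈ sumsOfTwoSquares := by
  induction k with
  | zero => simpa using one_mem_sumsOfTwoSquares
  | succ k ih => rw [pow_succ]; exact mul_mem_sumsOfTwoSquares ih hm

lemma sq_mem_sumsOfTwoSquares {m : ℕ} (hm : 0 < m) : m ^ 2 ∈ sumsOfTwoSquares :=
  ⟨by positivity, m, 0, by push_cast; ring⟩

lemma prime_mem_sumsOfTwoSquares {p : ℕ} (hp : p.Prime) (h : p % 4 ≠ 3) :
    p ∈ sumsOfTwoSquares := by
  have := Fact.mk hp
  obtain ⟨a, b, hab⟩ := Nat.Prime.sq_add_sq h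
  exact ⟨hp.pos, a, b, by exact_mod_cast hab⟩

lemma chi_prime_cases {p : ℕ} (hp : p.Prime) :
    p ∈ sumsOfTwoSquares ∨ chi p = -1 := by
  by_cases h : p % 4 = 3
  · right
    rw [chi_eq, if_neg (by omega), if_neg (by omega)]
  · exact Or.inl (prime_mem_sumsOfTwoSquares hp h)

/-- A prime power that is not a sum of two squares is an odd power of a prime congruent to 3 modulo
4; there `χ = -1` and the left side vanishes. Elsewhere `1 + χ ≤ 2` suffices. -/
lemma one_add_chi_mul_vonMangoldt_le (n : ℕ) : (1 + chi n) * Λ n ≤ 2 * (indSq n * Λ n) := by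
  by_cases hn : IsPrimePow n
  swap
  · rw [vonMangoldt_eq_zero_iff.2 hn]; simp
  have hΛ := vonMangoldt_nonneg (n := n)
  have hchi := abs_le.1 (abs_chi_le n)
  suffices n ∈ sumsOfTwoSquares ∨ chi n = -1 by
    rcases this with h | h
    · rw [indSq_of_mem h]; nlinarith
    · rw [h]
      have := indSq_nonneg n
      have : 0 ≤ indSq n * Λ n := mul_nonneg this hΛ
      linarith
  obtain ⟨p, k, hp, -, rfl⟩ := hn
  rw [← Nat.prime_iff] at hp
  rcases chi_prime_cases hp with h | h
  · exact Or.inl (pow_mem_sumsOfTwoSquares h k)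
  rcases Nat.even_or_odd k with ⟨j, rfl⟩ | hk
  · left
    rw [← two_mul, mul_comm, pow_mul]
    exact sq_mem_sumsOfTwoSquares (pow_pos hp.pos j)
  · right
    rw [chi_pow, h, hk.neg_one_pow]

/-- A Chebyshev lower bound for prime powers that are sums of two squares. -/
lemma le_sum_indSq_vonMangoldt : ∃ c : ℝ, 0 < c ∧ ∃ K : ℕ, 0 < K ∧ ∀ N : ℕ, K ≤ N →
    c * N ≤ ∑ n ∈ Ioc 0 N, indSq n * Λ n := by
  obtain ⟨C₁, h₁⟩ := abs_sum_vonMangoldt_div_sub_log_le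
  obtain ⟨C₂, h₂⟩ := abs_sum_chi_vonMangoldt_le
  -- `log K` exceeds twice the error in the combined Mertens estimate by 1, so the weighted sum over
  -- `(N / K, N]` is at least 1.
  obtain ⟨K, hK⟩ := exists_nat_ge (Real.exp (2 * C₁ + 2 * C₂ + 1))
  have hK0 : (0 : ℝ) < K := lt_of_lt_of_le (Real.exp_pos _) hK
  have hK1 : 0 < K := by exact_mod_cast hK0
  refine ⟨1 / (2 * K), by positivity, K, hK1, fun N hN => ?_⟩
  have hN0 : (0 : ℝ) < N := by exact_mod_cast lt_of_lt_of_le hK1 hN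
  set y := N / K with hy
  have hy0 : 0 < y := Nat.div_pos hN hK1
  have hy0' : (0 : ℝ) < y := by exact_mod_cast hy0
  set S : ℕ → ℝ := fun M => ∑ n ∈ Ioc 0 M, (1 + chi n) * (n : ℝ)⁻¹ * Λ n with hS
  have hSb : ∀ M : ℕ, 0 < M → |S M - Real.log M| ≤ C₁ + C₂ := by
    intro M hM
    have e : S M - Real.log M = (∑ n ∈ Ioc 0 M, (n : ℝ)⁻¹ * Λ n - Real.log M) +
        ∑ n ∈ Ioc 0 M, chi n * (n : ℝ)⁻¹ * Λ n := by
      have : S M = ∑ n ∈ Ioc 0 M, (n : ℝ)⁻¹ * Λ n + ∑ n ∈ Ioc 0 M, chi n * (n : ℝ)⁻¹ * Λ n := by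
        rw [← sum_add_distrib]
        exact sum_congr rfl fun n _ => by ring
      rw [this]; ring
    rw [e]
    exact (abs_add_le _ _).trans (add_le_add (h₁ M hM) (h₂ M hM))
  have b1 := abs_le.1 (hSb N (by omega))
  have b2 := abs_le.1 (hSb y hy0)
  have hlog : 2 * C₁ + 2 * C₂ + 1 ≤ Real.log N - Real.log y := by
    have h3 : Real.log K ≤ Real.log N - Real.log y := by
      rw [← Real.log_div hN0.ne' hy0'.ne']
      refine Real.log_le_log hK0 ?_
      rw [le_div_iff₀ hy0']
      exact_mod_cast Nat.mul_div_le N K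
    exact ((Real.le_log_iff_exp_le hK0).2 hK).trans h3
  have hdiff : 1 ≤ S N - S y := by linarith
  have hyN : y ≤ N := Nat.div_le_self N K
  have hw : ∀ n, 0 ≤ (1 + chi n) * Λ n := fun n =>
    mul_nonneg (by linarith [(abs_le.1 (abs_chi_le n)).1]) vonMangoldt_nonneg
  -- Every `n > ⌊N / K⌋` satisfies `n ≥ N / K`, so `1 / n ≤ K / N` removes the weight.
  have hup : S N - S y ≤ K / N * ∑ n ∈ Ioc 0 N, (1 + chi n) * Λ n := by
    have e : S N - S y = ∑ n ∈ Ioc y N, (1 + chi n) * (n : ℝ)⁻¹ * Λ n := by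
      simp only [hS]
      rw [← sum_Ioc_consecutive _ (Nat.zero_le y) hyN, add_sub_cancel_left]
    rw [e, mul_sum]
    calc _ ≤ ∑ n ∈ Ioc y N, K / N * ((1 + chi n) * Λ n) := by
          refine sum_le_sum fun n hn => ?_
          have hn1 : y + 1 ≤ n := (mem_Ioc.1 hn).1
          have : (n : ℝ)⁻¹ ≤ K / N := by
            rw [← inv_div]
            refine inv_anti₀ (by positivity) ?_
            have h4 := natCast_div_gt N hK1
            have h5 : ((y : ℝ) + 1) ≤ n := by exact_mod_cast hn1
            linarith
          calc _ = (n : ℝ)⁻¹ * ((1 + chi n) * Λ n) := by ring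
            _ ≤ _ := mul_le_mul_of_nonneg_right this (hw n)
      _ ≤ _ := by
          refine sum_le_sum_of_subset_of_nonneg (Ioc_subset_Ioc_left (Nat.zero_le y)) ?_
          exact fun n _ _ => mul_nonneg (by positivity) (hw n)
  have hfin : ∑ n ∈ Ioc 0 N, (1 + chi n) * Λ n ≤ 2 * ∑ n ∈ Ioc 0 N, indSq n * Λ n := by
    rw [mul_sum]
    exact sum_le_sum fun n _ => one_add_chi_mul_vonMangoldt_le n
  have h6 : 1 ≤ K / N * (2 * ∑ n ∈ Ioc 0 N, indSq n * Λ n) :=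
    (hdiff.trans hup).trans (mul_le_mul_of_nonneg_left hfin (by positivity))
  rw [div_mul_eq_mul_div, one_le_div hN0] at h6
  rw [div_mul_eq_mul_div, div_le_iff₀ (by positivity)]
  linarith

/-! ### Multiplicativity and comparison of divisor sums -/

lemma mem_sumsOfTwoSquares_iff {n : ℕ} (hn : 0 < n) :
    n ∈ sumsOfTwoSquares ↔ ∀ q ∈ n.primeFactors, q % 4 = 3 → Even (padicValNat q n) := by
  rw [← Nat.eq_sq_add_sq_iff]
  constructor
  · rintro ⟨-, a, b, h⟩
    refine ⟨a.natAbs, b.natAbs, ?_⟩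
    zify
    simp [h]
  · rintro ⟨a, b, h⟩
    exact ⟨hn, a, b, by rw [h]; push_cast; rfl⟩

/-- A prime dividing `m` has the same valuation in `m * n` as in `m`, so the parity criterion passes
to the factor. -/
lemma mem_sumsOfTwoSquares_of_mul {m n : ℕ} (hmn : m.Coprime n)
    (h : m * n ∈ sumsOfTwoSquares) : m ∈ sumsOfTwoSquares := by
  have h0 : 0 < m * n := h.1
  have hm : 0 < m := Nat.pos_of_mul_pos_right h0
  have hn : 0 < n := Nat.pos_of_mul_pos_left h0
  rw [mem_sumsOfTwoSquares_iff h0] at h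
  rw [mem_sumsOfTwoSquares_iff hm]
  intro q hq hq4
  have hqp := Nat.prime_of_mem_primeFactors hq
  have := Fact.mk hqp
  have hqm := Nat.dvd_of_mem_primeFactors hq
  have h1 := h q (Nat.mem_primeFactors.2 ⟨hqp, hqm.mul_right n, h0.ne'⟩) hq4
  rw [padicValNat.mul hm.ne' hn.ne', padicValNat.eq_zero_of_not_dvd (n := n), add_zero] at h1
  · exact h1
  · intro hqn
    exact hqp.one_lt.ne' (Nat.eq_one_of_dvd_coprimes hmn hqm hqn)

lemma isMultiplicative_indSq : indSq.IsMultiplicative := by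
  refine ⟨indSq_of_mem one_mem_sumsOfTwoSquares, fun {m n} hmn => ?_⟩
  refine le_antisymm ?_ (indSq_mul_le m n)
  by_cases h : m * n ∈ sumsOfTwoSquares
  · have h' : n * m ∈ sumsOfTwoSquares := by rwa [mul_comm]
    rw [indSq_of_mem h, indSq_of_mem (mem_sumsOfTwoSquares_of_mul hmn h),
      indSq_of_mem (mem_sumsOfTwoSquares_of_mul hmn.symm h'), mul_one]
  · rw [indSq_apply, if_neg h]
    exact mul_nonneg (indSq_nonneg m) (indSq_nonneg n)

/-- The character modulo `4` as an arithmetic function. -/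
noncomputable def chiFun : ArithmeticFunction ℝ := ⟨chi, by simp [chi_eq]⟩

lemma chiFun_apply (n : ℕ) : chiFun n = chi n := rfl

lemma isMultiplicative_chiFun : chiFun.IsMultiplicative :=
  ⟨chi_one, fun {m n} _ => chi_mul m n⟩

lemma indSq_mul_indSq_nonneg (n : ℕ) : 0 ≤ (indSq * indSq) n := by
  rw [mul_apply]
  exact sum_nonneg fun x _ => mul_nonneg (indSq_nonneg _) (indSq_nonneg _)

/-- If `p` is a sum of two squares, all `k + 1` factorizations of `p ^ k` count on the right, and
each term on the left is at most 1. Otherwise `χ(p) = -1` and the left side is 0 or 1; it is 1 only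
for even `k`, when the factorization `1 · p ^ k` counts. Nonnegativity is included so that the
inequalities can be multiplied over coprime factors. -/
lemma chiFun_mul_zeta_prime_pow {p : ℕ} (hp : p.Prime) (k : ℕ) :
    0 ≤ (chiFun * (zeta : ArithmeticFunction ℝ)) (p ^ k) ∧
      (chiFun * (zeta : ArithmeticFunction ℝ)) (p ^ k) ≤ (indSq * indSq) (p ^ k) := by
  have e : (chiFun * (zeta : ArithmeticFunction ℝ)) (p ^ k) = ∑ i ∈ range (k + 1), chi p ^ i := by
    rw [coe_mul_zeta_apply, Nat.sum_divisors_prime_pow hp]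
    exact sum_congr rfl fun i _ => chi_pow p i
  have hpk : p ^ k ≠ 0 := (pow_pos hp.pos k).ne'
  rcases chi_prime_cases hp with h | h
  · have hle : ∑ i ∈ range (k + 1), chi p ^ i ≤ k + 1 := by
      calc _ ≤ ∑ i ∈ range (k + 1), (1 : ℝ) := by
            refine sum_le_sum fun i _ => ?_
            rw [← chi_pow]
            exact (abs_le.1 (abs_chi_le _)).2
        _ = _ := by simp
    have hge : 0 ≤ chi p := by
      by_contra! hneg
      have h3 : p % 4 = 3 := by
        rw [chi_eq] at hneg
        split_ifs at hneg with h1 h2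
        · exact absurd hneg (lt_irrefl _)
        · linarith
        · omega
      have := (mem_sumsOfTwoSquares_iff hp.pos).1 h p
        (Nat.mem_primeFactors.2 ⟨hp, dvd_rfl, hp.ne_zero⟩) h3
      have hf := Fact.mk hp
      rw [padicValNat_self] at this
      exact absurd this (by decide)
    have hbb : (indSq * indSq) (p ^ k) = k + 1 := by
      rw [mul_apply, Nat.sum_divisorsAntidiagonal (f := fun a b => indSq a * indSq b),
        Nat.sum_divisors_prime_pow hp]
      calc _ = ∑ i ∈ range (k + 1), (1 : ℝ) := by
            refine sum_congr rfl fun i hi => ?_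
            rw [Nat.pow_div (by simpa [Nat.lt_succ_iff] using hi) hp.pos,
              indSq_of_mem (pow_mem_sumsOfTwoSquares h _),
              indSq_of_mem (pow_mem_sumsOfTwoSquares h _), mul_one]
        _ = _ := by simp
    rw [e, hbb]
    exact ⟨sum_nonneg fun i _ => pow_nonneg hge i, hle⟩
  · rw [e, h, neg_one_geom_sum]
    split_ifs with hk
    · exact ⟨le_rfl, indSq_mul_indSq_nonneg _⟩
    · refine ⟨zero_le_one, ?_⟩
      rw [mul_apply]
      have hk' : Even k := by
        rw [Nat.even_add_one, not_not] at hk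
        exact hk
      obtain ⟨j, rfl⟩ := hk'
      have hmem : p ^ (j + j) ∈ sumsOfTwoSquares := by
        rw [← two_mul, mul_comm, pow_mul]
        exact sq_mem_sumsOfTwoSquares (pow_pos hp.pos j)
      have := single_le_sum (f := fun x : ℕ × ℕ => indSq x.1 * indSq x.2)
        (fun x _ => mul_nonneg (indSq_nonneg x.1) (indSq_nonneg x.2))
        (show (1, p ^ (j + j)) ∈ (p ^ (j + j)).divisorsAntidiagonal by
          simp [hp.ne_zero])
      simpa [indSq_of_mem one_mem_sumsOfTwoSquares, indSq_of_mem hmem] using this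

/-- The number of representations as a sum of two squares, divided by four, is at most the number
of factorizations into two sums of two squares. -/
lemma chiFun_mul_zeta_le (n : ℕ) :
    0 ≤ (chiFun * (zeta : ArithmeticFunction ℝ)) n ∧
      (chiFun * (zeta : ArithmeticFunction ℝ)) n ≤ (indSq * indSq) n := by
  have hz : (zeta : ArithmeticFunction ℝ).IsMultiplicative := isMultiplicative_zeta.natCast
  have h1 := isMultiplicative_chiFun.mul hz
  have h2 := isMultiplicative_indSq.mul isMultiplicative_indSq
  induction n using Nat.recOnPrimeCoprime with
  | zero => simp
  | prime_pow p k hp => exact chiFun_mul_zeta_prime_pow hp k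
  | coprime a b _ _ hab iha ihb =>
    rw [h1.map_mul_of_coprime hab, h2.map_mul_of_coprime hab]
    exact ⟨mul_nonneg iha.1 ihb.1,
      mul_le_mul iha.2 ihb.2 ihb.1 (indSq_mul_indSq_nonneg a)⟩

/-! ### Lower bound for the number of sums of two squares -/

lemma log_le_sum_inv (N : ℕ) : Real.log N ≤ ∑ n ∈ Ioc 0 N, (n : ℝ)⁻¹ := by
  rcases Nat.eq_zero_or_pos N with rfl | hN
  · simp
  have h := log_add_one_le_harmonic N
  rw [harmonic_eq_sum_Icc] at h
  push_cast at h
  refine le_trans (Real.log_le_log (by exact_mod_cast hN) (by linarith)) h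

/-- The logarithmic density of the sums of two squares. -/
lemma log_le_sq_sum_inv_indSq {N : ℕ} (hN : 0 < N) :
    2 / 3 * Real.log N ≤ (∑ n ∈ Ioc 0 N, (n : ℝ)⁻¹ * indSq n) ^ 2 := by
  set H : ℕ → ℝ := fun M => ∑ m ∈ Ioc 0 M, (m : ℝ)⁻¹ with hH
  have Hmono : ∀ {M M' : ℕ}, M ≤ M' → H M ≤ H M' := fun h =>
    sum_le_sum_of_subset_of_nonneg (Ioc_subset_Ioc_right h) fun _ _ _ => by positivity
  have H0 : ∀ M, 0 ≤ H M := fun M => sum_nonneg fun _ _ => by positivity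
  have e1 : ∑ n ∈ Ioc 0 N, (n : ℝ)⁻¹ * (chiFun * (zeta : ArithmeticFunction ℝ)) n =
      ∑ d ∈ Ioc 0 N, chi d * ((d : ℝ)⁻¹ * H (N / d)) := by
    rw [sum_weight_mul (w := fun n => (n : ℝ)⁻¹) inv_natCast_mul]
    refine sum_congr rfl fun d _ => ?_
    rw [chiFun_apply, mul_comm _ (chi d), mul_assoc]
    congr 2
    refine sum_congr rfl fun m hm => ?_
    rw [zeta_apply_pos (mem_Ioc.1 hm).1, mul_one]
  -- The function `H (N / d) / d` decreases in `d`, so the sum is at least `H N - H (N / 3) / 3`,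
  -- hence at least `(2/3) H N`.
  have e2 := le_sum_chi_mul (f := fun d => (d : ℝ)⁻¹ * H (N / d)) (N := N)
    (fun d => mul_nonneg (by positivity) (H0 _))
    (fun n hn _ => mul_le_mul (inv_natCast_antitone (by omega) (Nat.le_succ n))
      (Hmono (Nat.div_le_div_left (Nat.le_succ n) (by omega))) (H0 _) (by positivity)) hN
  -- Enlarging each inner range from `N / d` to `N` turns the convolution sum into a square.
  have e3 : ∑ n ∈ Ioc 0 N, (n : ℝ)⁻¹ * (indSq * indSq) n ≤
      (∑ n ∈ Ioc 0 N, (n : ℝ)⁻¹ * indSq n) ^ 2 := by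
    rw [sum_weight_mul (w := fun n => (n : ℝ)⁻¹) inv_natCast_mul, sq, sum_mul]
    refine sum_le_sum fun d _ => ?_
    refine mul_le_mul_of_nonneg_left ?_ (mul_nonneg (by positivity) (indSq_nonneg d))
    exact sum_le_sum_of_subset_of_nonneg (Ioc_subset_Ioc_right (Nat.div_le_self N d))
      fun n _ _ => mul_nonneg (by positivity) (indSq_nonneg n)
  have e4 : ∑ n ∈ Ioc 0 N, (n : ℝ)⁻¹ * (chiFun * (zeta : ArithmeticFunction ℝ)) n ≤
      ∑ n ∈ Ioc 0 N, (n : ℝ)⁻¹ * (indSq * indSq) n :=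
    sum_le_sum fun n _ => mul_le_mul_of_nonneg_left (chiFun_mul_zeta_le n).2 (by positivity)
  have e5 : H (N / 3) ≤ H N := Hmono (Nat.div_le_self N 3)
  have e6 : Real.log N ≤ H N := log_le_sum_inv N
  simp only [Nat.cast_one, inv_one, Nat.div_one, one_mul, Nat.cast_ofNat] at e2
  linarith

/-- The number of sums of two squares up to `N` is at least of order `N / √(log N)`. -/
lemma le_sum_indSq : ∃ c : ℝ, 0 < c ∧ ∃ N₀ : ℕ, ∀ N : ℕ, N₀ ≤ N →
    c * N * √(Real.log N) ≤ (∑ n ∈ Ioc 0 N, indSq n) * Real.log N := by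
  obtain ⟨c, hc, K, hK, h⟩ := le_sum_indSq_vonMangoldt
  refine ⟨c / 4, by positivity, 4 * K ^ 2, fun N hN => ?_⟩
  have hK' : (1 : ℝ) ≤ K := by exact_mod_cast hK
  have hKN : K ≤ N := by nlinarith
  have hN0 : 0 < N := by omega
  have hN0' : (0 : ℝ) < N := by exact_mod_cast hN0
  have hN' : 4 * (K : ℝ) ^ 2 ≤ N := by exact_mod_cast hN
  let F : ArithmeticFunction ℝ := ⟨fun n => indSq n * Λ n, by simp⟩
  -- Supermultiplicativity gives `b(d) b(e) ≤ b(n)` for `d e = n`, and summing `Λ(e)` over the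
  -- divisors yields `log n`.
  have s1 : ∑ n ∈ Ioc 0 N, (indSq * F) n ≤ (∑ n ∈ Ioc 0 N, indSq n) * Real.log N := by
    rw [sum_mul]
    refine sum_le_sum fun n hn => ?_
    rw [mem_Ioc] at hn
    calc (indSq * F) n ≤ ∑ x ∈ n.divisorsAntidiagonal, indSq n * Λ x.2 := by
          rw [mul_apply]
          refine sum_le_sum fun x hx => ?_
          rw [← (Nat.mem_divisorsAntidiagonal.1 hx).1]
          calc indSq x.1 * F x.2 = indSq x.1 * indSq x.2 * Λ x.2 := by
                simp only [F, coe_mk]; ring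
            _ ≤ _ := mul_le_mul_of_nonneg_right (indSq_mul_le _ _) vonMangoldt_nonneg
      _ = indSq n * Real.log n := by
          rw [← mul_sum, Nat.sum_divisorsAntidiagonal' (f := fun _ b => Λ b), vonMangoldt_sum]
      _ ≤ indSq n * Real.log N := by
          refine mul_le_mul_of_nonneg_left ?_ (indSq_nonneg n)
          exact Real.log_le_log (by exact_mod_cast hn.1) (by exact_mod_cast hn.2)
  set M := N / K with hM
  -- Only `m ≤ N / K` is kept, where the Chebyshev bound applies to `N / m`; the factor `1/2` pays
  -- for the floor.
  have s2 : c / 2 * N * ∑ m ∈ Ioc 0 M, (m : ℝ)⁻¹ * indSq m ≤ ∑ n ∈ Ioc 0 N, (indSq * F) n := by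
    rw [sum_Ioc_mul_eq_sum_sum, mul_sum]
    have hFnn : ∀ n, 0 ≤ F n := fun n => mul_nonneg (indSq_nonneg n) vonMangoldt_nonneg
    refine le_trans ?_ (sum_le_sum_of_subset_of_nonneg
      (Ioc_subset_Ioc_right (Nat.div_le_self N K)) fun n _ _ =>
        mul_nonneg (indSq_nonneg n) (sum_nonneg fun m _ => hFnn m))
    refine sum_le_sum fun m hm => ?_
    rw [mem_Ioc] at hm
    have hm0 : (0 : ℝ) < m := by exact_mod_cast hm.1
    have hKm : K ≤ N / m := by
      rw [Nat.le_div_iff_mul_le hm.1, mul_comm]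
      exact (Nat.le_div_iff_mul_le hK).1 hm.2
    have h1 := h (N / m) hKm
    have h2 := natCast_div_gt N hm.1
    have h3 : (1 : ℝ) ≤ ((N / m : ℕ) : ℝ) := by exact_mod_cast hK.trans_le hKm
    have h4 : c / 2 * N * (m : ℝ)⁻¹ ≤ ∑ n ∈ Ioc 0 (N / m), F n := by
      refine le_trans ?_ h1
      rw [mul_assoc, ← div_eq_mul_inv]
      nlinarith
    calc _ = indSq m * (c / 2 * N * (m : ℝ)⁻¹) := by ring
      _ ≤ _ := mul_le_mul_of_nonneg_left h4 (indSq_nonneg m)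
  have hM0 : 0 < M := Nat.div_pos hKN hK
  have hM0' : (1 : ℝ) ≤ M := by exact_mod_cast hM0
  -- This is `√N ≤ M`: from `N < (M + 1) K ≤ 2 M K` and `4 K² ≤ N` follows `N² ≤ M² N`, which
  -- explains the threshold `4 * K ^ 2`.
  have s3 : Real.log N / 2 ≤ Real.log M := by
    rw [← Real.log_sqrt hN0'.le]
    refine Real.log_le_log (Real.sqrt_pos.2 hN0') (Real.sqrt_le_left (by linarith) |>.2 ?_)
    have h2 := natCast_div_gt N hK
    rw [div_lt_iff₀ (by linarith)] at h2
    have h5 : (N : ℝ) ≤ 2 * M * K := by nlinarith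
    have h6 : (N : ℝ) * N ≤ (2 * M * K) * (2 * M * K) := by gcongr
    have h7 : (N : ℝ) * N ≤ M ^ 2 * N := by nlinarith [sq_nonneg (M : ℝ)]
    exact le_of_mul_le_mul_right h7 hN0'
  have s4 : √(Real.log N) / 2 ≤ ∑ m ∈ Ioc 0 M, (m : ℝ)⁻¹ * indSq m := by
    have h8 := log_le_sq_sum_inv_indSq hM0
    have h9 : 0 ≤ ∑ m ∈ Ioc 0 M, (m : ℝ)⁻¹ * indSq m :=
      sum_nonneg fun m _ => mul_nonneg (by positivity) (indSq_nonneg m)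
    have h10 := Real.sq_sqrt (Real.log_natCast_nonneg N)
    have h11 := Real.log_natCast_nonneg N
    refine (pow_le_pow_iff_left₀ (by positivity) h9 two_ne_zero).1 ?_
    rw [div_pow, h10]
    linarith
  calc c / 4 * N * √(Real.log N) = c / 2 * N * (√(Real.log N) / 2) := by ring
    _ ≤ _ := (mul_le_mul_of_nonneg_left s4 (by positivity)).trans (s2.trans s1)

/-! ### Counting circles with a close pair of lattice points -/

/-- Two distinct lattice points on the circle of radius `√m` yield a factorization of `4 * m` into
sums of two squares, by writing their difference and sum in terms of a primitive vector. -/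
lemma exists_factorization {m : ℕ} {μ ν : ℤ × ℤ} (hμ : μ ∈ latticePoints m)
    (hν : ν ∈ latticePoints m) (hne : μ ≠ ν) :
    ∃ g h j k : ℕ, 0 < g ∧ 0 < h ∧ j ≤ h ∧ 4 * m = (g ^ 2 + k ^ 2) * (h ^ 2 + j ^ 2) ∧
      ((g ^ 2 * (h ^ 2 + j ^ 2) : ℕ) : ℤ) = (μ.1 - ν.1) ^ 2 + (μ.2 - ν.2) ^ 2 := by
  obtain ⟨a, b⟩ := μ
  obtain ⟨c, d⟩ := ν
  simp only [latticePoints, Set.mem_ofPred_eq] at hμ hν ⊢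
  have hgcd : 0 < Int.gcd (a - c) (b - d) := by
    rw [Int.gcd_pos_iff]
    by_contra! hcon
    exact hne (Prod.ext (by simpa using sub_eq_zero.1 hcon.1) (by simpa using sub_eq_zero.1 hcon.2))
  obtain ⟨g, p, q, hg, hpq, hp, hq⟩ := Int.exists_gcd_one' hgcd
  obtain ⟨u, v, huv⟩ := Int.isCoprime_iff_gcd_eq_one.2 hpq
  have hg0 : (g : ℤ) ≠ 0 := by exact_mod_cast hg.ne'
  have horth : p * (a + c) + q * (b + d) = 0 := by
    have : (g : ℤ) * (p * (a + c) + q * (b + d)) = 0 := by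
      linear_combination (-(a + c)) * hp - (b + d) * hq + hμ - hν
    exact (mul_eq_zero.1 this).resolve_left hg0
  -- With `u p + v q = 1`, this is the integer for which the sum vector, orthogonal to the primitive
  -- `(p, q)`, equals `t (q, -p)`.
  set t := v * (a + c) - u * (b + d) with ht
  have h1 : a + c = q * t := by rw [ht]; linear_combination (-(a + c)) * huv + u * horth
  have h2 : b + d = -(p * t) := by rw [ht]; linear_combination (-(b + d)) * huv + v * horth
  have h4m : (4 * m : ℤ) = (g ^ 2 + t ^ 2) * (p ^ 2 + q ^ 2) := by
    have e1 : (4 * m : ℤ) = (a - c) ^ 2 + (b - d) ^ 2 + ((a + c) ^ 2 + (b + d) ^ 2) := by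
      linear_combination (-2) * hμ - 2 * hν
    rw [e1, hp, hq, h1, h2]
    ring
  have hdist : (g : ℤ) ^ 2 * (p ^ 2 + q ^ 2) = (a - c) ^ 2 + (b - d) ^ 2 := by
    rw [hp, hq]; ring
  have hpq0 : p ≠ 0 ∨ q ≠ 0 := by
    by_contra! hcon
    simp [hcon.1, hcon.2] at hpq
  -- The larger coordinate takes the role of `h`, which makes it positive and bounds `j`.
  rcases le_total q.natAbs p.natAbs with hle | hle
  · refine ⟨g, p.natAbs, q.natAbs, t.natAbs, hg, by omega, hle, ?_, ?_⟩
    · zify; simpa using h4m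
    · push_cast; simpa using hdist
  · refine ⟨g, q.natAbs, p.natAbs, t.natAbs, hg, by omega, hle, ?_, ?_⟩
    · zify; rw [add_comm (|q| ^ 2)]; simpa using h4m
    · push_cast; rw [add_comm (|q| ^ 2)]; simpa using hdist

/-- The number of circles of radius at most `√x` with two lattice points at distance
at most `D`. -/
lemma card_close_pairs_le {x D : ℕ} (hD : D ≤ Nat.sqrt (4 * x)) (T : Finset ℕ)
    (hT : ∀ m ∈ T, m ≤ x ∧ ∃ μ ∈ latticePoints m, ∃ ν ∈ latticePoints m, μ ≠ ν ∧
      (μ.1 - ν.1) ^ 2 + (μ.2 - ν.2) ^ 2 ≤ (D : ℤ) ^ 2) :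
    T.card ≤ ∑ g ∈ Ioc 0 D, D / g * (4 * Nat.sqrt (4 * x)) := by
  set X := Nat.sqrt (4 * x) with hX
  let U : Finset ℕ := (Ioc 0 D).biUnion fun g => (Ioc 0 (D / g)).biUnion fun h =>
    (range (h + 1) ×ˢ range (X / h + 1)).image fun y => (g ^ 2 + y.2 ^ 2) * (h ^ 2 + y.1 ^ 2)
  have hsub : T.image (fun m => 4 * m) ⊆ U := by
    intro n hn
    obtain ⟨m, hm, rfl⟩ := mem_image.1 hn
    obtain ⟨hmx, μ, hμ, ν, hν, hne, hdist⟩ := hT m hm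
    obtain ⟨g, h, j, k, hg, hh, hj, hm4, hd⟩ := exists_factorization hμ hν hne
    have hgh : g * h ≤ D := by
      rw [← hd] at hdist
      have h1 : g ^ 2 * (h ^ 2 + j ^ 2) ≤ D ^ 2 := by exact_mod_cast hdist
      refine (Nat.pow_le_pow_iff_left two_ne_zero).1 (le_trans ?_ h1)
      rw [mul_pow]
      exact Nat.mul_le_mul_left _ (Nat.le_add_right _ _)
    have hkh : k * h ≤ X := by
      rw [hX, Nat.le_sqrt']
      calc (k * h) ^ 2 = k ^ 2 * h ^ 2 := mul_pow _ _ _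
        _ ≤ (g ^ 2 + k ^ 2) * (h ^ 2 + j ^ 2) :=
          Nat.mul_le_mul (Nat.le_add_left _ _) (Nat.le_add_right _ _)
        _ ≤ 4 * x := by omega
    have hhD : h ≤ D / g := by
      rw [Nat.le_div_iff_mul_le hg, mul_comm]; exact hgh
    have hkX : k ≤ X / h := by
      rw [Nat.le_div_iff_mul_le hh]; exact hkh
    have hgD : g ≤ D := le_trans (Nat.le_mul_of_pos_right g hh) hgh
    simp only [U, mem_biUnion, mem_image, mem_product, mem_range, mem_Ioc]
    exact ⟨g, ⟨hg, hgD⟩, h, ⟨hh, hhD⟩, (j, k), ⟨by omega, by omega⟩, hm4.symm⟩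
  calc T.card = (T.image (fun m => 4 * m)).card :=
        (card_image_of_injective _ fun a b h => by simpa using h).symm
    _ ≤ U.card := card_le_card hsub
    _ ≤ ∑ g ∈ Ioc 0 D, ∑ h ∈ Ioc 0 (D / g), 4 * X := by
        refine card_biUnion_le.trans (sum_le_sum fun g _ => card_biUnion_le.trans
          (sum_le_sum fun h hh => card_image_le.trans ?_))
        rw [card_product, card_range, card_range]
        rw [mem_Ioc] at hh
        have hhX : h ≤ X := (hh.2.trans (Nat.div_le_self D g)).trans hD
        have h1 : 1 ≤ X / h := Nat.div_pos hhX hh.1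
        have h2 : h * (X / h) ≤ X := Nat.mul_div_le X h
        -- Both `h` and `X / h` are at least 1, the latter because `h ≤ D ≤ X`; hence adding 1 at
        -- most doubles each.
        calc (h + 1) * (X / h + 1) ≤ (2 * h) * (2 * (X / h)) :=
              Nat.mul_le_mul (by omega) (by omega)
          _ = 4 * (h * (X / h)) := by ring
          _ ≤ 4 * X := by omega
    _ = _ := by simp

lemma sum_div_le (D : ℕ) : ((∑ g ∈ Ioc 0 D, D / g : ℕ) : ℝ) ≤ D * (1 + Real.log D) := by
  have h := harmonic_le_one_add_log D
  rw [harmonic_eq_sum_Icc] at h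
  push_cast at h ⊢
  calc _ ≤ ∑ g ∈ Ioc 0 D, (D : ℝ) * (g : ℝ)⁻¹ :=
        sum_le_sum fun g _ => by rw [← div_eq_mul_inv]; exact Nat.cast_div_le
    _ ≤ _ := by
        rw [← mul_sum]
        exact mul_le_mul_of_nonneg_left h (Nat.cast_nonneg D)

lemma card_close_pairs_le_log {x D : ℕ} (hD : D ≤ Nat.sqrt (4 * x)) (T : Finset ℕ)
    (hT : ∀ m ∈ T, m ≤ x ∧ ∃ μ ∈ latticePoints m, ∃ ν ∈ latticePoints m, μ ≠ ν ∧
      (μ.1 - ν.1) ^ 2 + (μ.2 - ν.2) ^ 2 ≤ (D : ℤ) ^ 2) :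
    (T.card : ℝ) ≤ 8 * √x * (D * (1 + Real.log D)) := by
  have h1 := card_close_pairs_le hD T hT
  rw [← sum_mul] at h1
  have h2 : ((Nat.sqrt (4 * x) : ℕ) : ℝ) ≤ 2 * √x := by
    have := Real.nat_sqrt_le_real_sqrt (a := 4 * x)
    push_cast at this
    rwa [Real.sqrt_mul (by norm_num), show (4 : ℝ) = 2 ^ 2 by norm_num,
      Real.sqrt_sq (by norm_num)] at this
  have h3 := sum_div_le D
  calc (T.card : ℝ) ≤ ((∑ g ∈ Ioc 0 D, D / g : ℕ) : ℝ) * (4 * (Nat.sqrt (4 * x) : ℕ)) := by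
        exact_mod_cast h1
    _ ≤ (D * (1 + Real.log D)) * (4 * (2 * √x)) := by
        gcongr
    _ = _ := by ring

lemma norm_toPlane_sub_sq (μ ν : ℤ × ℤ) :
    ‖toPlane μ - toPlane ν‖ ^ 2 = (((μ.1 - ν.1) ^ 2 + (μ.2 - ν.2) ^ 2 : ℤ) : ℝ) := by
  rw [EuclideanSpace.norm_sq_eq, Fin.sum_univ_two]
  simp [toPlane]

open Classical in
lemma ncard_sumsOfTwoSquares_le (x : ℕ) :
    ({m | m ∈ sumsOfTwoSquares ∧ m ≤ x}.ncard : ℝ) = ∑ n ∈ Ioc 0 x, indSq n := by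
  have e : {m | m ∈ sumsOfTwoSquares ∧ m ≤ x} =
      (((Ioc 0 x).filter fun m => m ∈ sumsOfTwoSquares : Finset ℕ) : Set ℕ) := by
    ext m
    simp only [Set.mem_ofPred_eq, coe_filter, mem_Ioc]
    exact ⟨fun h => ⟨⟨h.1.1, h.2⟩, h.1⟩, fun h => ⟨h.2, h.1.2⟩⟩
  rw [e, Set.ncard_coe_finset, card_filter]
  push_cast
  rfl

/-! ### The exceptional set and the conclusion -/

/-- Beyond `√x`, the separation bound is at most a uniform multiple of `√x / (log x) ^ A`. -/
lemma frequency_div_log_le {x m : ℕ} {A : ℝ} (hA : 0 < A) (hx : 1 < x) (hm : √x < m)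
    (hmx : m ≤ x) :
    frequency m / Real.log (frequency m) ^ A ≤
      2 * Real.pi * 4 ^ A * (√x / Real.log x ^ A) := by
  have hx' : (1 : ℝ) < x := by exact_mod_cast hx
  have hL : 0 < Real.log x := Real.log_pos hx'
  have hsx : 0 < √(x : ℝ) := Real.sqrt_pos.2 (by linarith)
  have hm0 : (0 : ℝ) < m := hsx.trans hm
  have hsm : 0 < √(m : ℝ) := Real.sqrt_pos.2 hm0
  have hpi := Real.pi_gt_three
  have h1 : frequency m ≤ 2 * Real.pi * √x := by
    unfold frequency
    gcongr
  -- As `m > √x`, the frequency exceeds the fourth root of `x`; this is the source of the factor `4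
  -- ^ A`.
  have h2 : Real.log x / 4 ≤ Real.log (frequency m) := by
    have e : Real.log x / 4 = Real.log (√x) / 2 := by rw [Real.log_sqrt (by linarith)]; ring
    rw [e, ← Real.log_sqrt hsx.le]
    refine Real.log_le_log (Real.sqrt_pos.2 hsx) ?_
    calc √√x ≤ √m := Real.sqrt_le_sqrt hm.le
      _ ≤ frequency m := by
        unfold frequency
        nlinarith
  have h3 : (Real.log x / 4) ^ A ≤ Real.log (frequency m) ^ A :=
    Real.rpow_le_rpow (by positivity) h2 hA.le
  calc _ ≤ (2 * Real.pi * √x) / (Real.log x / 4) ^ A := by gcongr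
    _ = _ := by
      rw [Real.div_rpow hL.le (by norm_num)]
      field_simp

/-- The exceptional set, bounded at the scale `y` of the separation. -/
lemma ncard_exceptional_le {A : ℝ} (hA : 0 < A) {x : ℕ} {y : ℝ}
    (hy : y = 2 * Real.pi * 4 ^ A * (√x / Real.log x ^ A)) (h1 : 1 ≤ y) (h2 : y ≤ √x)
    (hx : 4 ≤ x) :
    ({m | m ∈ sumsOfTwoSquares ∧ m ≤ x ∧ ¬ ∀ μ₁ ∈ latticePoints m, ∀ μ₂ ∈ latticePoints m,
        μ₁ ≠ μ₂ → 1 * (frequency m / Real.log (frequency m) ^ A) ≤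
          ‖toPlane μ₁ - toPlane μ₂‖}.ncard : ℝ) ≤ √x + 32 * √x * y * Real.log x := by
  classical
  set P : ℕ → Prop := fun m => ∀ μ₁ ∈ latticePoints m, ∀ μ₂ ∈ latticePoints m,
        μ₁ ≠ μ₂ → 1 * (frequency m / Real.log (frequency m) ^ A) ≤ ‖toPlane μ₁ - toPlane μ₂‖
  have hx' : (4 : ℝ) ≤ x := by exact_mod_cast hx
  have hs2 : 2 ≤ √(x : ℝ) := Real.le_sqrt_of_sq_le (by linarith)
  have hss : √(x : ℝ) * √x = x := Real.mul_self_sqrt (by linarith)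
  -- An integer scale is needed for the count. The bound `1 ≤ y` keeps `D ≤ 2 y`, and `y ≤ √x` keeps
  -- `D ≤ 2 √x`, so that `log D ≤ log x`.
  set D := ⌈y⌉₊ with hD
  have hDy : (D : ℝ) ≤ 2 * y := by
    have := Nat.ceil_lt_add_one (show 0 ≤ y by linarith)
    linarith
  have hyD : y ≤ D := Nat.le_ceil y
  have hDx : (D : ℝ) ≤ 2 * √x := by linarith
  have hDs : D ≤ Nat.sqrt (4 * x) := by
    rw [Nat.le_sqrt]
    have : (D : ℝ) * D ≤ 4 * x := by nlinarith
    exact_mod_cast this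
  have hD0 : (0 : ℝ) < D := by linarith
  have hlogx : 1 ≤ Real.log x := by
    have h4 : Real.log 4 = 2 * Real.log 2 := by
      rw [show (4 : ℝ) = 2 ^ 2 by norm_num, Real.log_pow]; norm_num
    have := Real.log_two_gt_d9
    have := Real.log_le_log (by norm_num) hx'
    linarith
  have hlogD : Real.log D ≤ Real.log x := Real.log_le_log hD0 (by nlinarith)
  set T := (Ioc 0 x).filter fun m : ℕ => √x < m ∧ ¬ P m with hT
  have hTc := card_close_pairs_le_log hDs T (by
    intro m hm
    rw [hT, mem_filter, mem_Ioc] at hm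
    obtain ⟨⟨-, hmx⟩, hmx', hP⟩ := hm
    refine ⟨hmx, ?_⟩
    simp only [P] at hP
    push Not at hP
    obtain ⟨μ, hμ, ν, hν, hne, hlt⟩ := hP
    refine ⟨μ, hμ, ν, hν, hne, ?_⟩
    have hle : ‖toPlane μ - toPlane ν‖ ≤ D := by
      have := frequency_div_log_le hA (by omega) hmx' hmx
      rw [← hy] at this
      linarith
    have hsq := pow_le_pow_left₀ (norm_nonneg _) hle 2
    rw [norm_toPlane_sub_sq] at hsq
    exact_mod_cast hsq)
  -- The `m ≤ √x`, where the uniform separation bound is unavailable, are all counted as exceptional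
  -- at a cost of `√x`.
  have hsub : {m | m ∈ sumsOfTwoSquares ∧ m ≤ x ∧ ¬ P m} ⊆
      ((Ioc 0 ⌊√(x : ℝ)⌋₊ ∪ T : Finset ℕ) : Set ℕ) := by
    rintro m ⟨hm, hmx, hP⟩
    simp only [coe_union, Set.mem_union, mem_coe, mem_Ioc, hT, mem_filter]
    rcases lt_or_ge (√(x : ℝ)) m with h | h
    · exact Or.inr ⟨⟨hm.1, hmx⟩, h, hP⟩
    · exact Or.inl ⟨hm.1, Nat.le_floor h⟩
  have hcard : {m | m ∈ sumsOfTwoSquares ∧ m ≤ x ∧ ¬ P m}.ncard ≤ ⌊√(x : ℝ)⌋₊ + T.card := by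
    refine (Set.ncard_le_ncard hsub (finite_toSet _)).trans ?_
    rw [Set.ncard_coe_finset]
    refine (card_union_le _ _).trans ?_
    simp
  calc ({m | m ∈ sumsOfTwoSquares ∧ m ≤ x ∧ ¬ P m}.ncard : ℝ)
      ≤ (⌊√(x : ℝ)⌋₊ : ℝ) + T.card := by exact_mod_cast hcard
    _ ≤ √x + 8 * √x * (D * (1 + Real.log D)) :=
        add_le_add (Nat.floor_le (Real.sqrt_nonneg _)) hTc
    _ ≤ √x + 8 * √x * (2 * y * (2 * Real.log x)) := by
        gcongr
        · linarith
    _ = _ := by ring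

lemma tendsto_log_rpow_neg {r : ℝ} (hr : 0 < r) :
    Tendsto (fun x : ℝ => Real.log x ^ (-r)) atTop (𝓝 0) :=
  (tendsto_rpow_neg_atTop hr).comp Real.tendsto_log_atTop

lemma tendsto_log_rpow_div_sqrt (r : ℝ) :
    Tendsto (fun x : ℝ => Real.log x ^ r / √x) atTop (𝓝 0) := by
  simp only [Real.sqrt_eq_rpow]
  exact (isLittleO_log_rpow_rpow_atTop r (by norm_num)).tendsto_div_nhds_zero

end ToralSeparation

open ToralSeparation in
theorem mainTheorem9 (ε : ℝ) (hε : 0 < ε) :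
    ∃ c : ℝ, 0 < c ∧
      ToralSeparation.AlmostAllIn ToralSeparation.sumsOfTwoSquares (fun m =>
        ∀ μ₁ ∈ ToralSeparation.latticePoints m, ∀ μ₂ ∈ ToralSeparation.latticePoints m,
          μ₁ ≠ μ₂ →
            c * (ToralSeparation.frequency m /
                Real.log (ToralSeparation.frequency m) ^ (3 / 2 + ε)) ≤
              ‖ToralSeparation.toPlane μ₁ - ToralSeparation.toPlane μ₂‖) := by
  -- Any positive constant would do, since the saving `(log x) ^ (-ε)` absorbs it.
  refine ⟨1, one_pos, ?_⟩
  obtain ⟨c, hc, N₀, hB⟩ := le_sum_indSq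
  set C : ℝ := 2 * Real.pi * 4 ^ (3 / 2 + ε) with hC
  have hC0 : 0 < C := by positivity
  have hA : 0 < 3 / 2 + ε := by linarith
  -- This is the quotient of the bound for the exceptional set by the lower bound `c x / √(log x)`
  -- for the sums of two squares.
  have hlim : Tendsto (fun x : ℝ => 1 / c * (Real.log x ^ (1 / 2 : ℝ) / √x +
      32 * C * Real.log x ^ (-ε))) atTop (𝓝 0) := by
    simpa using ((tendsto_log_rpow_div_sqrt (1 / 2)).add
      ((tendsto_log_rpow_neg hε).const_mul (32 * C))).const_mul (1 / c)
  -- These two eventual bounds say that the scale `y = C √x / (log x) ^ (3/2 + ε)` lies between 1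
  -- and `√x`.
  have ev1 : ∀ᶠ x : ℝ in atTop, Real.log x ^ (3 / 2 + ε) / √x < C :=
    (tendsto_log_rpow_div_sqrt _).eventually_lt_const hC0
  have ev2 : ∀ᶠ x : ℝ in atTop, Real.log x ^ (-(3 / 2 + ε)) < 1 / C :=
    (tendsto_log_rpow_neg hA).eventually_lt_const (by positivity)
  refine squeeze_zero' (Eventually.of_forall fun x => by positivity) ?_
    (hlim.comp tendsto_natCast_atTop_atTop)
  filter_upwards [tendsto_natCast_atTop_atTop.eventually ev1,
    tendsto_natCast_atTop_atTop.eventually ev2, eventually_ge_atTop N₀, eventually_ge_atTop 4]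
    with x e1 e2 hN hx
  have hx' : (4 : ℝ) ≤ x := by exact_mod_cast hx
  have hL : 0 < Real.log x := Real.log_pos (by linarith)
  have hs : 0 < √(x : ℝ) := Real.sqrt_pos.2 (by linarith)
  have hss : √(x : ℝ) * √x = x := Real.mul_self_sqrt (by linarith)
  have hLA : 0 < Real.log x ^ (3 / 2 + ε) := Real.rpow_pos_of_pos hL _
  have hnum := ncard_exceptional_le hA (x := x) rfl
    (by
      rw [← hC, mul_div_assoc', le_div_iff₀ hLA, one_mul]
      exact ((div_lt_iff₀ hs).1 e1).le)
    (by
      rw [Real.rpow_neg hL.le, lt_div_iff₀ hC0] at e2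
      rw [← hC, div_eq_mul_inv]
      nlinarith)
    hx
  have hden := hB x hN
  rw [← ncard_sumsOfTwoSquares_le] at hden
  rw [← hC] at hnum
  have hLsq : √(Real.log x) * √(Real.log x) = Real.log x := Real.mul_self_sqrt hL.le
  have hLs : 0 < √(Real.log x) := Real.sqrt_pos.2 hL
  have hden' : c * x / √(Real.log x) ≤
      ({m | m ∈ sumsOfTwoSquares ∧ m ≤ x}.ncard : ℝ) := by
    rw [div_le_iff₀ hLs]
    refine le_of_mul_le_mul_right ?_ hLs
    rwa [mul_assoc (Set.ncard _ : ℝ), hLsq]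
  refine (div_le_div₀ (by positivity) hnum (by positivity) hden').trans (le_of_eq ?_)
  have hpow : Real.log x ^ (3 / 2 + ε) = Real.log x * √(Real.log x) * Real.log x ^ ε := by
    rw [Real.rpow_add hL, show (3 / 2 : ℝ) = 1 + 1 / 2 by norm_num, Real.rpow_add hL,
      Real.rpow_one, Real.sqrt_eq_rpow]
  have hLe : 0 < Real.log x ^ ε := Real.rpow_pos_of_pos hL _
  simp only [Function.comp_apply]
  rw [hpow, Real.rpow_neg hL.le, ← Real.sqrt_eq_rpow]
  generalize Real.log x ^ ε = E at *
  generalize √(Real.log x) = l at *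
  rw [← hLsq]
  generalize √(x : ℝ) = s at *
  rw [← hss]
  field_simp
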